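/- Let $n\ge 1$, let $S^{n-1}$ be the unit sphere and $B^n$ the closed unit Euclidean ball of $\mathbb{R}^n$, and let $du$ denote the spherical (surface area) measure on $S^{n-1}$. Let $\mathcal{K}_{(o)}^n$ be the set of compact convex subsets of $\mathbb{R}^n$ containing the origin in their interiors. For $K\in\mathcal{K}_{(o)}^n$ let $h_K(u)=\max_{x\in K}\langle x,u\rangle$ and $\rho_K(u)=\max\{\lambda\ge 0:\lambda u\in K\}$ ($u\in S^{n-1}$) be its support and radial functions, and $K^\circ=\{x\in\mathbb{R}^n:\langle x,y\rangle\le 1\ \forall y\in K\}$ its polar body. Let $\varphi:(0,\infty)\to(0,\infty)$ be continuous and strictly increasing with $\lim_{t\to0^+}\varphi(t)=0$, $\varphi(1)=1$ and $\lim_{t\to\infty}\varphi(t)=\infty$. Let $\mu$ be a nonzero finite Borel measure on $S^{n-1}$ that is not concentrated on any closed hemisphere. Let $G:(0,\infty)\times S^{n-1}\to(0,\infty)$ be continuous and such that, for every $u\in S^{n-1}$, $t\mapsto G(t,u)$ is strictly increasing with $\lim_{t\to0^+}G(t,u)=0$ and $\lim_{t\to\infty}G(t,u)=\infty$; assume moreover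 that for some real $q\ge n-1$ $$\inf\Big\{\frac{G(t,u)}{t^q}:\ t\ge 1,\ u\in S^{n-1}\Big\}>0 .$$ For $K\in\mathcal{K}_{(o)}^n$ put $$\widetilde V_G(K)=\int_{S^{n-1}}G(\rho_K(u),u)\,du,\qquad \widehat V_G(K)=\inf\Big\{\eta>0:\ \int_{S^{n-1}}G\Big(\frac{\rho_K(u)}{\eta},u\Big)du\le 1\Big\},$$ $$\widetilde{\mathcal B}=\{Q\in\mathcal{K}_{(o)}^n:\widetilde V_G(Q^\circ)=\widetilde V_G(B^n)\},\qquad \widehat{\mathcal B}=\{Q\in\mathcal{K}_{(o)}^n:\widehat V_G(Q^\circ)=\widehat V_G(B^n)\}.$$ Then the following statements hold. (i) There exists $\widetilde M\in\widetilde{\mathcal B}$ such that $$\int_{S^{n-1}}\varphi(h_{\widetilde M}(u))\,d\mu(u)=\inf\Big\{\int_{S^{n-1}}\varphi(h_Q(u))\,d\mu(u):\ Q\in\widetilde{\mathcal B}\Big\}.$$ If, in addition, $\varphi$ is convex and $G(\cdot,u)$ is convex on $(0,\infty)$ for every $u\in S^{n-1}$, then such an $\widetilde M$ is unique. (ii)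 There exists $\widehat M\in\widehat{\mathcal B}$ such that $$\int_{S^{n-1}}\varphi(h_{\widehat M}(u))\,d\mu(u)=\inf\Big\{\int_{S^{n-1}}\varphi(h_Q(u))\,d\mu(u):\ Q\in\widehat{\mathcal B}\Big\}.$$ If, in addition, $\varphi$ is convex and $G(\cdot,u)$ is convex on $(0,\infty)$ for every $u\in S^{n-1}$, then such an $\widehat M$ is unique. -/

import Mathlib

open MeasureTheory Set Filter Topology

noncomputable section

namespace DualPolarOrlicz

/-- Euclidean `n`-space. -/
abbrev E (n : ℕ) : Type := EuclideanSpace ℝ (Fin n)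

/-- The unit sphere of `ℝⁿ`, with its Borel σ-algebra. -/
abbrev Sph (n : ℕ) : Type := Metric.sphere (0 : E n) 1

/-- The unit Euclidean ball of `ℝⁿ`. -/
def unitBall (n : ℕ) : Set (E n) := Metric.closedBall 0 1

/-- The spherical (surface area) measure on the unit sphere. -/
def sphMeasure (n : ℕ) : Measure (Sph n) := (volume : Measure (E n)).toSphere

variable {n : ℕ}

/-- Support function `h_K(u) = max {⟨x, u⟩ : x ∈ K}`. -/
def supportFun (K : Set (E n)) (u : Sph n) : ℝ :=
  sSup ((fun x : E n => inner ℝ x (u : E n)) '' K)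

/-- Radial function `ρ_K(u) = max {r ≥ 0 : r u ∈ K}`. -/
def radialFun (K : Set (E n)) (u : Sph n) : ℝ :=
  sSup {r : ℝ | 0 ≤ r ∧ r • (u : E n) ∈ K}

/-- Polar body `K° = {x : ⟨x, y⟩ ≤ 1 for all y ∈ K}`. -/
def polarBody (K : Set (E n)) : Set (E n) :=
  {x | ∀ y ∈ K, inner ℝ x y ≤ (1 : ℝ)}

/-- Convex bodies with the origin in their interior. -/
def bodiesO (n : ℕ) : Set (ConvexBody (E n)) :=
  {K | (0 : E n) ∈ interior (K : Set (E n))}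

/-- General dual volume `∫ G(ρ_K(u), u) du`. -/
def dualVol (G : ℝ → Sph n → ℝ) (K : Set (E n)) : ℝ :=
  ∫ u, G (radialFun K u) u ∂(sphMeasure n)

/-- Homogeneous general dual volume for `G` increasing in its first variable:
`inf {η > 0 : ∫ G(ρ_K(u)/η, u) du ≤ 1}`. -/
def homDualVol (G : ℝ → Sph n → ℝ) (K : Set (E n)) : ℝ :=
  sInf {η : ℝ | 0 < η ∧ ∫ u, G (radialFun K u / η) u ∂(sphMeasure n) ≤ 1}

/-- Functions `φ : (0,∞) → (0,∞)` that are continuous and strictly increasing, with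
`φ(0+) = 0`, `φ(1) = 1`, `φ(∞) = ∞`. Values outside `(0,∞)` are irrelevant. -/
structure ClassI (φ : ℝ → ℝ) : Prop where
  pos : ∀ t, 0 < t → 0 < φ t
  continuousOn : ContinuousOn φ (Ioi 0)
  strictMonoOn : StrictMonoOn φ (Ioi 0)
  tendsto_zero : Tendsto φ (𝓝[>] 0) (𝓝 0)
  map_one : φ 1 = 1
  tendsto_top : Tendsto φ atTop atTop

/-- Functions `G : (0,∞) × S^{n-1} → (0,∞)` that are (jointly) continuous and, for every fixed
`u`, strictly increasing in `t` with limits `0` at `0+` and `∞` at `∞`.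
Values at `t ≤ 0` are irrelevant. -/
structure ClassGI (G : ℝ → Sph n → ℝ) : Prop where
  pos : ∀ t u, 0 < t → 0 < G t u
  continuousOn : ContinuousOn (fun p : ℝ × Sph n => G p.1 p.2) (Ioi 0 ×ˢ univ)
  strictMonoOn : ∀ u, StrictMonoOn (fun t => G t u) (Ioi 0)
  tendsto_zero : ∀ u, Tendsto (fun t => G t u) (𝓝[>] 0) (𝓝 0)
  tendsto_top : ∀ u, Tendsto (fun t => G t u) atTop atTop

/-- `inf {G(t,u) / t^q : t ≥ 1, u ∈ S^{n-1}} > 0`. -/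
def GrowthCond (G : ℝ → Sph n → ℝ) (q : ℝ) : Prop :=
  0 < sInf ((fun p : ℝ × Sph n => G p.1 p.2 / p.1 ^ q) '' (Ici 1 ×ˢ univ))

/-- `μ` is concentrated on some closed hemisphere `{u : ⟨u, v⟩ ≥ 0}`, `v ∈ S^{n-1}`. -/
def ConcentratedOnHemisphere (μ : Measure (Sph n)) : Prop :=
  ∃ v : Sph n, μ {u : Sph n | 0 ≤ (inner ℝ (u : E n) (v : E n) : ℝ)}ᶜ = 0

/-- The bodies `Q` whose polar body has the same general dual volume as the unit ball. -/
def tildeB (G : ℝ → Sph n → ℝ) : Set (ConvexBody (E n)) :=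
  {Q | Q ∈ bodiesO n ∧ dualVol G (polarBody (Q : Set (E n))) = dualVol G (unitBall n)}

/-- The bodies `Q` whose polar body has the same homogeneous general dual volume as the
unit ball. -/
def hatB (G : ℝ → Sph n → ℝ) : Set (ConvexBody (E n)) :=
  {Q | Q ∈ bodiesO n ∧ homDualVol G (polarBody (Q : Set (E n))) = homDualVol G (unitBall n)}

/-- The objective `∫ φ(h_Q(u)) dμ(u)`. -/
def objective (φ : ℝ → ℝ) (μ : Measure (Sph n)) (Q : ConvexBody (E n)) : ℝ :=
  ∫ u, φ (supportFun (Q : Set (E n)) u) ∂μ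

/-- `M ∈ B` and `∫ φ(h_M) dμ = inf {∫ φ(h_Q) dμ : Q ∈ B}`. -/
def IsSolution (φ : ℝ → ℝ) (μ : Measure (Sph n)) (B : Set (ConvexBody (E n)))
    (M : ConvexBody (E n)) : Prop :=
  M ∈ B ∧ objective φ μ M = sInf (objective φ μ '' B)

end DualPolarOrlicz

end

/-!
Since `ρ_{Q°} = 1 / h_Q`, both constraints are conditions on `∫ G(1 / h_Q(u), u) du`. As
`∫ G(tη, u) du` is strictly increasing in `t`, the homogeneous constraint is the ordinary one for
the rescaled function `(t, u) ↦ G(tη, u)`, where `∫ G(η, u) du = 1`.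

*Existence.* Bodies with bounded objective are uniformly bounded: if they contained points running
to infinity in directions converging to `w`, then `h_Q(u) → ∞` for all `u` with `⟨u, w⟩ > 0`, a set
of positive `μ`-measure. By Blaschke selection a minimising sequence therefore has a subsequence
converging to a convex body `M`. If `h_M(u) = 0` for some `u`, then `h_M(v) ≤ R |v - u|`, so by the
growth condition the lower limit of the integrands `G(1 / h_Q(v), v)` is at least
`c |v - u|^{-(n-1)}`. Caps of radius `r` have measure at least `d r^{n-1}`, so this lower limit is
not integrable, contradicting Fatou's lemma. Hence `h_M > 0`, and everything passes to the limit.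

*Uniqueness.* If `G(·, u)` is convex, then `t ↦ G(1 / t, u)` is strictly convex. The midpoint of two
distinct minimisers then has a polar body of too small dual volume and can be shrunk into the
constraint set, which strictly decreases the objective.
-/

namespace DualPolarOrlicz

section Integral

theorem liminf_ofReal_eq_top {ι : Type*} {l : Filter ι} [l.NeBot] {x : ι → ℝ}
    (h : Tendsto x l atTop) : liminf (fun i => ENNReal.ofReal (x i)) l = ⊤ :=
  (ENNReal.tendsto_ofReal_atTop.comp h).liminf_eq

variable {X : Type*} [TopologicalSpace X]

theorem continuous_uncurry_comp {Y Z : Type*} [TopologicalSpace Y] [TopologicalSpace Z]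
    {H : Y → X → Z} {U : Set Y} (hH : ContinuousOn (fun p : Y × X => H p.1 p.2) (U ×ˢ univ))
    {f : X → Y} (hf : Continuous f) (hfU : ∀ u, f u ∈ U) : Continuous fun u => H (f u) u :=
  hH.comp_continuous (hf.prodMk continuous_id) fun u => ⟨hfU u, mem_univ _⟩

theorem continuousOn_comp_inv {Y : Type*} [TopologicalSpace Y] {H : ℝ → X → Y}
    (hH : ContinuousOn (fun p : ℝ × X => H p.1 p.2) (Ioi 0 ×ˢ univ)) :
    ContinuousOn (fun p : ℝ × X => H p.1⁻¹ p.2) (Ioi 0 ×ˢ univ) :=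
  hH.comp (g := fun p : ℝ × X => H p.1 p.2) (f := fun p : ℝ × X => (p.1⁻¹, p.2))
    ((continuousOn_fst.inv₀ fun _ hp => (mem_prod.1 hp).1.ne').prodMk continuousOn_snd)
    fun _ hp => ⟨mem_Ioi.2 (inv_pos.2 hp.1), mem_univ _⟩

theorem exists_forall_lt_of_tendsto_atTop [CompactSpace X] {G : ℝ → X → ℝ} {a : ℝ}
    (hcont : ∀ t ∈ Ioi a, Continuous (G t)) (hmono : ∀ u, MonotoneOn (fun t => G t u) (Ioi a))
    (htop : ∀ u, Tendsto (fun t => G t u) atTop atTop) (c : ℝ) : ∃ t ∈ Ioi a, ∀ u, c < G t u := by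
  obtain ⟨t, ht⟩ := isCompact_univ.elim_directed_cover (fun t : Ioi a => {u | c < G t u})
    (fun t => isOpen_lt continuous_const (hcont t t.2))
    (fun u _ => by
      obtain ⟨t, htc, ht⟩ := (((htop u).eventually_gt_atTop c).and (eventually_gt_atTop a)).exists
      exact mem_iUnion.2 ⟨⟨t, ht⟩, htc⟩)
    (directed_of_isDirected_le fun s t hst u (hu : c < G s u) => hu.trans_le (hmono u s.2 t.2 hst))
  exact ⟨t, t.2, fun u => ht (mem_univ u)⟩

variable [CompactSpace X] [MeasurableSpace X] [OpensMeasurableSpace X] {ν : Measure X}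
  [IsFiniteMeasure ν]

theorem integrable_of_continuous {f : X → ℝ} (hf : Continuous f) : Integrable f ν :=
  hf.integrable_of_hasCompactSupport (.of_compactSpace f)

theorem integral_lt_integral_of_continuous {f g : X → ℝ} (hf : Continuous f) (hg : Continuous g)
    (hle : ∀ u, f u ≤ g u) (hlt : ν {u | f u < g u} ≠ 0) :
    ∫ u, f u ∂ν < ∫ u, g u ∂ν := by
  rw [← sub_pos, ← integral_sub (integrable_of_continuous hg) (integrable_of_continuous hf),
    integral_pos_iff_support_of_nonneg (fun u => sub_nonneg.2 (hle u))
      (integrable_of_continuous (hg.sub hf)), pos_iff_ne_zero]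
  exact fun h => hlt (measure_mono_null (fun u hu => (sub_pos.2 hu).ne') h)

theorem strictMonoOn_integral [NeZero ν] {G : ℝ → X → ℝ} {s : Set ℝ}
    (hcont : ∀ t ∈ s, Continuous (G t)) (hmono : ∀ u, StrictMonoOn (fun t => G t u) s) :
    StrictMonoOn (fun t => ∫ u, G t u ∂ν) s := fun t ht t' ht' htt' =>
  integral_lt_integral_of_continuous (hcont t ht) (hcont t' ht')
    (fun u => (hmono u ht ht' htt').le) fun h =>
      NeZero.ne ν (Measure.measure_univ_eq_zero.1
        (measure_mono_null (fun u _ => hmono u ht ht' htt') h))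

theorem lintegral_liminf_le_of_integral_le {F : ℕ → X → ℝ} {c : ℝ}
    (hF : ∀ i, Continuous (F i)) (h0 : ∀ i u, 0 ≤ F i u) (hc : ∀ i, ∫ u, F i u ∂ν ≤ c) :
    ∫⁻ u, liminf (fun i => ENNReal.ofReal (F i u)) atTop ∂ν ≤ ENNReal.ofReal c := by
  refine (lintegral_liminf_le fun i => (hF i).measurable.ennreal_ofReal).trans
    (liminf_le_of_le (by isBoundedDefault) fun a ha => ?_)
  obtain ⟨i, hi⟩ := ha.exists
  rw [← ofReal_integral_eq_lintegral_ofReal (integrable_of_continuous (hF i))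
    (ae_of_all _ (h0 i))] at hi
  exact hi.trans (ENNReal.ofReal_le_ofReal (hc i))

theorem measure_tendsto_atTop_eq_zero_of_integral_le {F : ℕ → X → ℝ} {c : ℝ}
    (hF : ∀ i, Continuous (F i)) (h0 : ∀ i u, 0 ≤ F i u) (hc : ∀ i, ∫ u, F i u ∂ν ≤ c) :
    ν {u | Tendsto (fun i => F i u) atTop atTop} = 0 := by
  have hmeas : Measurable fun u => liminf (fun i => ENNReal.ofReal (F i u)) atTop :=
    .liminf fun i => (hF i).measurable.ennreal_ofReal
  exact measure_mono_null (fun u hu => liminf_ofReal_eq_top hu)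
    (measure_eq_top_of_lintegral_ne_top hmeas.aemeasurable
      (ne_top_of_le_ne_top ENNReal.ofReal_ne_top (lintegral_liminf_le_of_integral_le hF h0 hc)))

theorem tendsto_integral_of_tendstoUniformly {Y : Type*} [PseudoMetricSpace Y] [ProperSpace Y]
    {H : Y → X → ℝ} {U : Set Y} (hU : IsOpen U)
    (hH : ContinuousOn (fun p : Y × X => H p.1 p.2) (U ×ˢ univ))
    {ι : Type*} {l : Filter ι} [l.IsCountablyGenerated] {F : ι → X → Y} {f : X → Y}
    (hF : ∀ i, Continuous (F i)) (hf : Continuous f) (hfU : ∀ u, f u ∈ U)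
    (hlim : TendstoUniformly F f l) :
    Tendsto (fun i => ∫ u, H (F i u) u ∂ν) l (𝓝 (∫ u, H (f u) u ∂ν)) := by
  obtain ⟨δ, hδ, hδU⟩ := (isCompact_range hf).exists_cthickening_subset_open hU
    (range_subset_iff.2 hfU)
  set K := Metric.cthickening δ (range f)
  have hK : IsCompact K := (isCompact_range hf).cthickening
  have hFK : ∀ᶠ i in l, ∀ u, F i u ∈ K := by
    filter_upwards [Metric.tendstoUniformly_iff.1 hlim δ hδ] with i hi u
    exact Metric.mem_cthickening_of_dist_le _ _ _ _ (mem_range_self u)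
      (dist_comm (f u) _ ▸ (hi u).le)
  obtain ⟨C, hC⟩ := (hK.prod isCompact_univ).exists_bound_of_continuousOn
    (hH.mono (prod_mono hδU Subset.rfl))
  refine tendsto_integral_filter_of_dominated_convergence (fun _ => C) ?_ ?_
    (integrable_const C) (ae_of_all _ fun u => ?_)
  · filter_upwards [hFK] with i hi
    exact (continuous_uncurry_comp hH (hF i) fun u => hδU (hi u)).aestronglyMeasurable
  · filter_upwards [hFK] with i hi
    exact ae_of_all _ fun u => hC (F i u, u) ⟨hi u, mem_univ u⟩
  · exact (hH.continuousAt (prod_mem_nhds (hU.mem_nhds (hfU u)) univ_mem)).tendsto.comp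
      ((hlim.tendsto_at u).prodMk_nhds tendsto_const_nhds)

theorem integral_comp_combo_le {H : ℝ → X → ℝ} {s : Set ℝ}
    (hH : ContinuousOn (fun p : ℝ × X => H p.1 p.2) (s ×ˢ univ))
    (hconv : ∀ u, ConvexOn ℝ s fun t => H t u) {f g : X → ℝ} (hf : Continuous f)
    (hg : Continuous g) (hfs : ∀ u, f u ∈ s) (hgs : ∀ u, g u ∈ s) {a b : ℝ} (ha : 0 ≤ a)
    (hb : 0 ≤ b) (hab : a + b = 1) :
    ∫ u, H (a * f u + b * g u) u ∂ν ≤ a * ∫ u, H (f u) u ∂ν + b * ∫ u, H (g u) u ∂ν := by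
  have hcf := continuous_uncurry_comp hH hf hfs
  have hcg := continuous_uncurry_comp hH hg hgs
  have hcfg : Continuous fun u => H (a * f u + b * g u) u :=
    continuous_uncurry_comp hH (by fun_prop) fun u => (hconv u).1 (hfs u) (hgs u) ha hb hab
  rw [← integral_const_mul, ← integral_const_mul, ← integral_add
    ((integrable_of_continuous hcf).const_mul a) ((integrable_of_continuous hcg).const_mul b)]
  exact integral_mono (integrable_of_continuous hcfg)
    (integrable_of_continuous ((hcf.const_mul a).add (hcg.const_mul b)))
    fun u => (hconv u).2 (hfs u) (hgs u) ha hb hab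

theorem integral_comp_combo_lt [ν.IsOpenPosMeasure] {H : ℝ → X → ℝ} {s : Set ℝ}
    (hH : ContinuousOn (fun p : ℝ × X => H p.1 p.2) (s ×ˢ univ))
    (hconv : ∀ u, StrictConvexOn ℝ s fun t => H t u) {f g : X → ℝ} (hf : Continuous f)
    (hg : Continuous g) (hfs : ∀ u, f u ∈ s) (hgs : ∀ u, g u ∈ s) (hfg : f ≠ g) {a b : ℝ}
    (ha : 0 < a) (hb : 0 < b) (hab : a + b = 1) :
    ∫ u, H (a * f u + b * g u) u ∂ν < a * ∫ u, H (f u) u ∂ν + b * ∫ u, H (g u) u ∂ν := by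
  have hcf := continuous_uncurry_comp hH hf hfs
  have hcg := continuous_uncurry_comp hH hg hgs
  have hcfg : Continuous fun u => H (a * f u + b * g u) u :=
    continuous_uncurry_comp hH (by fun_prop) fun u =>
      (hconv u).1 (hfs u) (hgs u) ha.le hb.le hab
  rw [← integral_const_mul, ← integral_const_mul, ← integral_add
    ((integrable_of_continuous hcf).const_mul a) ((integrable_of_continuous hcg).const_mul b)]
  refine integral_lt_integral_of_continuous hcfg ((hcf.const_mul a).add (hcg.const_mul b))
    (fun u => (hconv u).convexOn.2 (hfs u) (hgs u) ha.le hb.le hab) fun h => ?_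
  obtain ⟨u, hu⟩ := Function.ne_iff.1 hfg
  exact (isOpen_ne_fun hf hg).measure_ne_zero ν ⟨u, hu⟩
    (measure_mono_null (fun v hv => (hconv v).2 (hfs v) (hgs v) hv ha hb hab) h)

theorem continuousOn_integral {Y : Type*} [PseudoMetricSpace Y] [ProperSpace Y]
    {H : Y → X → ℝ} {U : Set Y} (hU : IsOpen U)
    (hH : ContinuousOn (fun p : Y × X => H p.1 p.2) (U ×ˢ univ)) :
    ContinuousOn (fun t => ∫ u, H t u ∂ν) U := fun t ht =>
  (tendsto_integral_of_tendstoUniformly hU hH (fun _ => continuous_const) continuous_const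
    (fun _ => ht) (Metric.tendstoUniformly_iff.2 fun ε hε => by
      filter_upwards [Metric.ball_mem_nhds t hε] with s hs _
      exact Metric.mem_ball'.1 hs)).mono_left nhdsWithin_le_nhds

theorem tendsto_integral_nhdsGT_zero {G : ℝ → X → ℝ} {a : ℝ}
    (hcont : ∀ t ∈ Ioi a, Continuous (G t)) (hmono : ∀ u, MonotoneOn (fun t => G t u) (Ioi a))
    (hzero : ∀ u, Tendsto (fun t => G t u) (𝓝[>] a) (𝓝 0)) :
    Tendsto (fun t => ∫ u, G t u ∂ν) (𝓝[>] a) (𝓝 0) := by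
  have hnonneg : ∀ t ∈ Ioi a, ∀ u, 0 ≤ G t u := fun t ht u => by
    refine le_of_tendsto (hzero u) ?_
    filter_upwards [Ioo_mem_nhdsGT ht] with s hs
    exact hmono u hs.1 ht hs.2.le
  obtain ⟨b, hb⟩ := exists_gt a
  have h : Tendsto (fun t => ∫ u, G t u ∂ν) (𝓝[>] a) (𝓝 (∫ _, 0 ∂ν)) := by
    refine tendsto_integral_filter_of_dominated_convergence (G b) ?_ ?_
      (integrable_of_continuous (hcont b hb)) (ae_of_all _ hzero)
    · filter_upwards [self_mem_nhdsWithin] with t ht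
      exact (hcont t ht).aestronglyMeasurable
    · filter_upwards [Ioo_mem_nhdsGT hb] with t ht
      refine ae_of_all _ fun u => ?_
      rw [Real.norm_of_nonneg (hnonneg t ht.1 u)]
      exact hmono u ht.1 hb ht.2.le
  rwa [integral_zero] at h

theorem exists_integral_eq_of_monotoneOn [NeZero ν] {G : ℝ → X → ℝ} {a : ℝ}
    (hG : ContinuousOn (fun p : ℝ × X => G p.1 p.2) (Ioi a ×ˢ univ))
    (hmono : ∀ u, MonotoneOn (fun t => G t u) (Ioi a))
    (hzero : ∀ u, Tendsto (fun t => G t u) (𝓝[>] a) (𝓝 0))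
    (htop : ∀ u, Tendsto (fun t => G t u) atTop atTop) {c : ℝ} (hc : 0 < c) :
    ∃ t ∈ Ioi a, ∫ u, G t u ∂ν = c := by
  have hcont : ∀ t ∈ Ioi a, Continuous (G t) := fun t ht =>
    continuous_uncurry_comp hG continuous_const fun _ => ht
  have hν : 0 < ν.real univ := measureReal_univ_pos
  obtain ⟨t₀, ht₀c, ht₀⟩ := (((tendsto_integral_nhdsGT_zero (ν := ν) hcont hmono
    hzero).eventually_le_const hc).and self_mem_nhdsWithin).exists
  obtain ⟨t₁, ht₁, hlt⟩ := exists_forall_lt_of_tendsto_atTop hcont hmono htop (c / ν.real univ)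
  have ht₁c : c ≤ ∫ u, G t₁ u ∂ν := calc
    c = ∫ _, c / ν.real univ ∂ν := by
      rw [integral_const, smul_eq_mul, mul_div_cancel₀ _ hν.ne']
    _ ≤ ∫ u, G t₁ u ∂ν :=
      integral_mono (integrable_const _) (integrable_of_continuous (hcont t₁ ht₁))
        fun u => (hlt u).le
  exact isPreconnected_Ioi.intermediate_value ht₀ ht₁ (continuousOn_integral isOpen_Ioi hG)
    ⟨ht₀c, ht₁c⟩

end Integral

variable {n : ℕ}

section Support

open Metric Pointwise TopologicalSpace

variable {K L : Set (E n)} {u : Sph n}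

theorem norm_coe_sph (u : Sph n) : ‖(u : E n)‖ = 1 := norm_eq_of_mem_sphere u

theorem dim_ne_zero (u : Sph n) : n ≠ 0 := by
  rintro rfl
  exact one_ne_zero ((norm_coe_sph u).symm.trans (by
    rw [Subsingleton.elim (u : E 0) 0, norm_zero]))

theorem supportFun_eq_of_isGreatest {c : ℝ}
    (h : IsGreatest ((fun x : E n => inner ℝ x (u : E n)) '' K) c) : supportFun K u = c :=
  h.csSup_eq

theorem inner_le_supportFun (hK : IsCompact K) {x : E n} (hx : x ∈ K) (u : Sph n) :
    inner ℝ x (u : E n) ≤ supportFun K u :=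
  le_csSup (hK.image (by fun_prop)).bddAbove (mem_image_of_mem _ hx)

theorem exists_inner_eq_supportFun (hK : IsCompact K) (hne : K.Nonempty) (u : Sph n) :
    ∃ x ∈ K, inner ℝ x (u : E n) = supportFun K u :=
  (hK.image (f := fun x : E n => inner ℝ x (u : E n)) (by fun_prop)).sSup_mem (hne.image _)

theorem supportFun_le_iff (hK : IsCompact K) (hne : K.Nonempty) {c : ℝ} :
    supportFun K u ≤ c ↔ ∀ x ∈ K, inner ℝ x (u : E n) ≤ c := by
  rw [supportFun, csSup_le_iff (hK.image (by fun_prop)).bddAbove (hne.image _), forall_mem_image]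

theorem supportFun_le_add_mul_dist (hK : IsCompact K) (hne : K.Nonempty) {R : ℝ}
    (hR : ∀ x ∈ K, ‖x‖ ≤ R) (u v : Sph n) :
    supportFun K u ≤ supportFun K v + R * dist u v := by
  refine (supportFun_le_iff hK hne).2 fun x hx => ?_
  calc inner ℝ x (u : E n) = inner ℝ x (v : E n) + inner ℝ x ((u : E n) - v) := by
        rw [inner_sub_right, add_sub_cancel]
    _ ≤ supportFun K v + ‖x‖ * dist u v :=
        add_le_add (inner_le_supportFun hK hx v)
          ((real_inner_le_norm _ _).trans_eq (by rw [Subtype.dist_eq, dist_eq_norm]))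
    _ ≤ supportFun K v + R * dist u v := by gcongr; exact hR x hx

theorem continuous_supportFun (hK : IsCompact K) (hne : K.Nonempty) :
    Continuous (supportFun K) := by
  obtain ⟨R, hR⟩ := hK.isBounded.exists_norm_le
  have hR₀ : 0 ≤ R := (norm_nonneg _).trans (hR _ hne.some_mem)
  exact (LipschitzWith.of_le_add_mul ⟨R, hR₀⟩ (supportFun_le_add_mul_dist hK hne hR)).continuous

theorem continuous_supportFun_convexBody (K : ConvexBody (E n)) :
    Continuous (supportFun (K : Set (E n))) :=
  continuous_supportFun K.isCompact K.nonempty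

theorem supportFun_le_add_dist (K L : NonemptyCompacts (E n)) (u : Sph n) :
    supportFun K u ≤ supportFun L u + dist K L := by
  refine (supportFun_le_iff K.isCompact K.nonempty).2 fun x hx => ?_
  obtain ⟨y, hy, hxy⟩ := L.isCompact.exists_infDist_eq_dist L.nonempty x
  have hdist : dist x y ≤ dist K L := hxy ▸ infDist_le_hausdorffDist_of_mem hx
    (hausdorffEDist_ne_top_of_nonempty_of_bounded K.nonempty L.nonempty
      K.isCompact.isBounded L.isCompact.isBounded)
  calc inner ℝ x (u : E n) = inner ℝ y (u : E n) + inner ℝ (x - y) (u : E n) := by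
        rw [inner_sub_left, add_sub_cancel]
    _ ≤ supportFun L u + dist x y :=
        add_le_add (inner_le_supportFun L.isCompact hy u)
          ((real_inner_le_norm _ _).trans_eq (by rw [norm_coe_sph, mul_one, dist_eq_norm]))
    _ ≤ supportFun L u + dist K L := by gcongr

theorem tendstoUniformly_supportFun {ι : Type*} {l : Filter ι} {K : ι → NonemptyCompacts (E n)}
    {L : NonemptyCompacts (E n)} (h : Tendsto K l (𝓝 L)) :
    TendstoUniformly (fun i => supportFun (K i : Set (E n))) (supportFun L) l := by
  refine Metric.tendstoUniformly_iff.2 fun ε hε => ?_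
  filter_upwards [Metric.tendsto_nhds.1 h ε hε] with i hi u
  refine lt_of_le_of_lt (abs_sub_le_iff.2 ⟨?_, ?_⟩) hi
  · rw [sub_le_iff_le_add', dist_comm]
    exact supportFun_le_add_dist L (K i) u
  · exact sub_le_iff_le_add'.2 (supportFun_le_add_dist (K i) L u)

theorem supportFun_add (hK : IsCompact K) (hK' : K.Nonempty) (hL : IsCompact L)
    (hL' : L.Nonempty) (u : Sph n) :
    supportFun (K + L) u = supportFun K u + supportFun L u := by
  obtain ⟨x, hx, hxu⟩ := exists_inner_eq_supportFun hK hK' u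
  obtain ⟨y, hy, hyu⟩ := exists_inner_eq_supportFun hL hL' u
  refine supportFun_eq_of_isGreatest ⟨⟨x + y, add_mem_add hx hy, ?_⟩, ?_⟩
  · simp only [inner_add_left, hxu, hyu]
  · rintro _ ⟨_, ⟨a, ha, b, hb, rfl⟩, rfl⟩
    simp only [inner_add_left]
    exact add_le_add (inner_le_supportFun hK ha u) (inner_le_supportFun hL hb u)

theorem supportFun_smul (K : Set (E n)) {c : ℝ} (hc : 0 ≤ c) (u : Sph n) :
    supportFun (c • K) u = c * supportFun K u := by
  rw [supportFun, supportFun, ← smul_eq_mul, ← Real.sSup_smul_of_nonneg hc]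
  simp only [← image_smul, image_image, real_inner_smul_left, smul_eq_mul]

theorem supportFun_combo (K L : ConvexBody (E n)) {a b : ℝ} (ha : 0 ≤ a) (hb : 0 ≤ b)
    (u : Sph n) : supportFun ((a • K + b • L : ConvexBody (E n)) : Set (E n)) u =
      a * supportFun (K : Set (E n)) u + b * supportFun (L : Set (E n)) u := by
  rw [ConvexBody.coe_add, supportFun_add (a • K).isCompact (a • K).nonempty (b • L).isCompact
    (b • L).nonempty, ConvexBody.coe_smul, ConvexBody.coe_smul, supportFun_smul _ ha,
    supportFun_smul _ hb]

theorem supportFun_closedBall {r : ℝ} (hr : 0 ≤ r) (u : Sph n) :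
    supportFun (closedBall (0 : E n) r) u = r := by
  refine supportFun_eq_of_isGreatest ⟨⟨r • (u : E n), ?_, ?_⟩, ?_⟩
  · rw [mem_closedBall_zero_iff, norm_smul, norm_coe_sph, mul_one, Real.norm_of_nonneg hr]
  · simp only [real_inner_smul_left, real_inner_self_eq_norm_sq, norm_coe_sph, one_pow, mul_one]
  · rintro _ ⟨x, hx, rfl⟩
    calc inner ℝ x (u : E n) ≤ ‖x‖ * ‖(u : E n)‖ := real_inner_le_norm _ _
      _ ≤ r := by rw [norm_coe_sph, mul_one]; exact mem_closedBall_zero_iff.1 hx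

theorem supportFun_mono (hK : K.Nonempty) (hL : IsCompact L) (hKL : K ⊆ L) (u : Sph n) :
    supportFun K u ≤ supportFun L u :=
  csSup_le_csSup (hL.image (by fun_prop)).bddAbove (hK.image _) (image_mono hKL)

theorem exists_supportFun_lt_inner (hK : Convex ℝ K) (hc : IsCompact K) (hne : K.Nonempty)
    {x : E n} (hx : x ∉ K) : ∃ u : Sph n, supportFun K u < inner ℝ x (u : E n) := by
  obtain ⟨f, s, hf, hs⟩ := geometric_hahn_banach_closed_point hK hc.isClosed hx
  set w : E n := (InnerProductSpace.toDual ℝ (E n)).symm f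
  have hw : ∀ y, inner ℝ y w = f y := fun y => by
    rw [real_inner_comm, InnerProductSpace.toDual_symm_apply]
  have hw₀ : w ≠ 0 := fun h₀ => by
    obtain ⟨y, hy⟩ := hne
    have := (hf y hy).trans hs
    rw [← hw, ← hw, h₀, inner_zero_right, inner_zero_right] at this
    exact this.false
  have hnorm : 0 < ‖w‖ := norm_pos_iff.2 hw₀
  let v : Sph n := ⟨‖w‖⁻¹ • w, by
    rw [mem_sphere_zero_iff_norm, norm_smul, norm_inv, norm_norm, inv_mul_cancel₀ hnorm.ne']⟩
  obtain ⟨y, hy, hyv⟩ := exists_inner_eq_supportFun hc hne v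
  refine ⟨v, ?_⟩
  rw [← hyv, real_inner_smul_right, real_inner_smul_right, hw, hw]
  exact mul_lt_mul_of_pos_left ((hf y hy).trans hs) (inv_pos.2 hnorm)

theorem subset_iff_supportFun_le (hK : IsCompact K) (hK' : K.Nonempty) (hL : Convex ℝ L)
    (hL' : IsCompact L) (hne : L.Nonempty) :
    K ⊆ L ↔ ∀ u, supportFun K u ≤ supportFun L u := by
  refine ⟨supportFun_mono hK' hL', fun h x hx => by_contra fun hxL => ?_⟩
  obtain ⟨u, hu⟩ := exists_supportFun_lt_inner hL hL' hne hxL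
  exact (inner_le_supportFun hK hx u).not_gt ((h u).trans_lt hu)

theorem supportFun_injective :
    Function.Injective fun K : ConvexBody (E n) => supportFun (K : Set (E n)) :=
  fun K L h => ConvexBody.ext <| Subset.antisymm
    ((subset_iff_supportFun_le K.isCompact K.nonempty L.convex L.isCompact L.nonempty).2
      fun u => (congrFun h u).le)
    ((subset_iff_supportFun_le L.isCompact L.nonempty K.convex K.isCompact K.nonempty).2
      fun u => (congrFun h u).ge)

theorem mem_bodiesO_iff {K : ConvexBody (E n)} :
    K ∈ bodiesO n ↔ ∀ u, 0 < supportFun (K : Set (E n)) u := by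
  have hsub : ∀ {r : ℝ}, 0 < r →
      (closedBall (0 : E n) r ⊆ K ↔ ∀ u, r ≤ supportFun (K : Set (E n)) u) := fun {r} hr => by
    rw [subset_iff_supportFun_le (isCompact_closedBall _ _) (nonempty_closedBall.2 hr.le)
      K.convex K.isCompact K.nonempty]
    simp only [supportFun_closedBall hr.le]
  rw [bodiesO, mem_ofPred_eq, mem_interior_iff_mem_nhds, nhds_basis_closedBall.mem_iff]
  constructor
  · rintro ⟨r, hr, hrK⟩ u
    exact hr.trans_le ((hsub hr).1 hrK u)
  · intro h
    obtain ⟨r, hr, hrK⟩ := isCompact_univ.exists_forall_le'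
      (continuous_supportFun_convexBody K).continuousOn fun u _ => h u
    exact ⟨r, hr, (hsub hr).2 fun u => hrK u (mem_univ u)⟩

theorem radialFun_polarBody (hK : IsCompact K) (hne : K.Nonempty) (hu : 0 < supportFun K u) :
    radialFun (polarBody K) u = (supportFun K u)⁻¹ := by
  have : {r : ℝ | 0 ≤ r ∧ r • (u : E n) ∈ polarBody K} = Icc 0 (supportFun K u)⁻¹ := by
    ext r
    refine and_congr_right fun hr => ?_
    calc (∀ x ∈ K, inner ℝ (r • (u : E n)) x ≤ 1)
        ↔ ∀ x ∈ r • K, inner ℝ x (u : E n) ≤ 1 := by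
          simp only [← image_smul, forall_mem_image, real_inner_smul_left,
            real_inner_comm _ (u : E n)]
      _ ↔ r ≤ (supportFun K u)⁻¹ := by
          rw [← supportFun_le_iff (hK.smul r) (hne.smul_set), supportFun_smul K hr,
            ← one_div, le_div_iff₀ hu]
  rw [radialFun, this, csSup_Icc (inv_pos.2 hu).le]

theorem radialFun_unitBall (u : Sph n) : radialFun (unitBall n) u = 1 := by
  have : {r : ℝ | 0 ≤ r ∧ r • (u : E n) ∈ unitBall n} = Icc 0 1 := by
    ext r
    refine and_congr_right fun hr => ?_
    rw [unitBall, mem_closedBall_zero_iff, norm_smul, norm_coe_sph, mul_one,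
      Real.norm_of_nonneg hr]
  rw [radialFun, this, csSup_Icc zero_le_one]

end Support

section Blaschke

open Metric TopologicalSpace

variable {F : Type*} [NormedAddCommGroup F] [NormedSpace ℝ F]

theorem convex_iff_infDist_le {s : Set F} (hs : IsCompact s) (hne : s.Nonempty) :
    Convex ℝ s ↔ ∀ x y : F, ∀ a b : ℝ, 0 ≤ a → 0 ≤ b → a + b = 1 →
      infDist (a • x + b • y) s ≤ a * infDist x s + b * infDist y s := by
  refine ⟨fun hconv x y a b ha hb hab => ?_, fun h x hx y hy a b ha hb hab => ?_⟩
  · obtain ⟨x', hx', hxx'⟩ := hs.exists_infDist_eq_dist hne x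
    obtain ⟨y', hy', hyy'⟩ := hs.exists_infDist_eq_dist hne y
    calc infDist (a • x + b • y) s ≤ dist (a • x + b • y) (a • x' + b • y') :=
          infDist_le_dist_of_mem (hconv hx' hy' ha hb hab)
      _ ≤ dist (a • x) (a • x') + dist (b • y) (b • y') := dist_add_add_le _ _ _ _
      _ = a * infDist x s + b * infDist y s := by
          rw [dist_smul₀, dist_smul₀, hxx', hyy', Real.norm_of_nonneg ha, Real.norm_of_nonneg hb]
  · rw [hs.isClosed.mem_iff_infDist_zero hne]
    refine le_antisymm ((h x y a b ha hb hab).trans_eq ?_) infDist_nonneg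
    rw [infDist_zero_of_mem hx, infDist_zero_of_mem hy, mul_zero, mul_zero, add_zero]

theorem isClosed_setOf_convex : IsClosed {K : NonemptyCompacts F | Convex ℝ (K : Set F)} := by
  have hinf : ∀ x : F, Continuous fun K : NonemptyCompacts F => infDist x K :=
    fun x => (lipschitz_infDist_set x).continuous
  simp only [fun K : NonemptyCompacts F => convex_iff_infDist_le K.isCompact K.nonempty,
    ofPred_forall]
  exact isClosed_iInter fun x => isClosed_iInter fun y => isClosed_iInter fun a =>
    isClosed_iInter fun b => isClosed_iInter fun _ => isClosed_iInter fun _ =>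
    isClosed_iInter fun _ => isClosed_le (hinf _)
      (((hinf x).const_mul a).add ((hinf y).const_mul b))

theorem exists_subseq_tendstoUniformly_supportFun (Q : ℕ → ConvexBody (E n)) {R : ℝ}
    (hR : ∀ i, ∀ x ∈ Q i, ‖x‖ ≤ R) : ∃ (M : ConvexBody (E n)) (s : ℕ → ℕ), StrictMono s ∧
      TendstoUniformly (fun i => supportFun (Q (s i) : Set (E n))) (supportFun (M : Set (E n)))
        atTop := by
  let K : ℕ → NonemptyCompacts (E n) := fun i => ⟨⟨Q i, (Q i).isCompact⟩, (Q i).nonempty⟩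
  have hcompact : IsCompact ({K : NonemptyCompacts (E n) | (K : Set (E n)) ⊆ closedBall 0 R} ∩
      {K | Convex ℝ (K : Set (E n))}) :=
    (NonemptyCompacts.isCompact_subsets_of_isCompact (isCompact_closedBall 0 R)).inter_right
      isClosed_setOf_convex
  obtain ⟨L, ⟨-, hL⟩, s, hs, hlim⟩ := hcompact.tendsto_subseq (x := K) fun i =>
    ⟨fun x hx => mem_closedBall_zero_iff.2 (hR i x hx), (Q i).convex⟩
  exact ⟨⟨L, hL, L.isCompact, L.nonempty⟩, s, hs, tendstoUniformly_supportFun hlim⟩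

end Blaschke

section Singularity

open Metric Pointwise
open scoped ENNReal

theorem lintegral_eq_top_of_div_edist_pow_le {X : Type*} [MetricSpace X] [MeasurableSpace X]
    [OpensMeasurableSpace X] {σ : Measure X} {F : X → ℝ≥0∞} {u : X} {s : ℕ} {c d : ℝ≥0∞}
    (hc : c ≠ 0) (hd : d ≠ 0) (hσ : ∀ᶠ r in 𝓝[>] 0, d * ENNReal.ofReal r ^ s ≤ σ (ball u r))
    (hF : ∀ᶠ v in 𝓝[≠] u, c / edist v u ^ s ≤ F v) (hFu : F u = ⊤) : ∫⁻ v, F v ∂σ = ⊤ := by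
  -- If `F` were integrable, `F σ` would give small balls around `u` mass near that of `{u}`; the
  -- hypotheses keep this mass at least `c * d`, so `u` would be an atom at which `F = ⊤`.
  by_contra hfin
  have hle : ∀ᶠ r in 𝓝[>] (0 : ℝ), c * d ≤ σ.withDensity F (ball u r) := by
    obtain ⟨ε, hε, hεF⟩ := nhdsWithin_basis_ball.eventually_iff.1 hF
    filter_upwards [hσ, Ioo_mem_nhdsGT hε] with r hr ⟨hr₀, hrε⟩
    have hrpow : ENNReal.ofReal r ^ s ≠ 0 := pow_ne_zero _ (ENNReal.ofReal_pos.2 hr₀).ne'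
    calc c * d = c / ENNReal.ofReal r ^ s * (d * ENNReal.ofReal r ^ s) := by
          rw [mul_comm d, ← mul_assoc, ENNReal.div_mul_cancel hrpow (by finiteness)]
      _ ≤ c / ENNReal.ofReal r ^ s * σ (ball u r) := by gcongr
      _ = ∫⁻ _ in ball u r, c / ENNReal.ofReal r ^ s ∂σ := (setLIntegral_const _ _).symm
      _ ≤ ∫⁻ v in ball u r, F v ∂σ := setLIntegral_mono' measurableSet_ball fun v hv => by
          obtain rfl | hvu := eq_or_ne v u
          · exact hFu ▸ le_top
          refine le_trans ?_ (hεF ⟨ball_subset_ball hrε.le hv, hvu⟩)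
          gcongr
          exact (edist_lt_ofReal.2 hv).le
      _ = σ.withDensity F (ball u r) := (withDensity_apply _ measurableSet_ball).symm
  have hlim : Tendsto (fun r => σ.withDensity F (ball u r)) (𝓝[>] 0)
      (𝓝 (σ.withDensity F {u})) := by
    rw [← closedBall_zero, ← biInter_gt_ball u 0]
    refine tendsto_measure_biInter_gt (fun r _ => measurableSet_ball.nullMeasurableSet)
      (fun r t _ hrt => ball_subset_ball hrt) ⟨1, one_pos, ?_⟩
    rw [withDensity_apply _ measurableSet_ball]
    exact ne_top_of_le_ne_top hfin (setLIntegral_le_lintegral _ _)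
  have hσu : σ {u} ≠ 0 := fun h => mul_ne_zero hc hd <|
    le_zero_iff.1 ((ge_of_tendsto hlim hle).trans_eq (withDensity_absolutelyContinuous σ F h))
  refine hfin (top_unique ?_)
  calc ⊤ = F u * σ {u} := by rw [hFu, ENNReal.top_mul hσu]
    _ = ∫⁻ v in {u}, F v ∂σ := (lintegral_singleton F u).symm
    _ ≤ ∫⁻ v, F v ∂σ := setLIntegral_le_lintegral _ _

theorem eventually_div_edist_pow_le_liminf {X : Type*} [MetricSpace X] {G : ℝ → X → ℝ} {s : ℕ}
    {c T : ℝ} (hc : 0 < c) (hgr : ∀ t, T ≤ t → ∀ v, c * t ^ s ≤ G t v) {ι : Type*} {l : Filter ι}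
    {h : ι → X → ℝ} (hpos : ∀ i v, 0 < h i v) {f : X → ℝ}
    (hlim : ∀ v, Tendsto (fun i => h i v) l (𝓝 (f v))) {u : X} {R : ℝ} (hR : 0 < R)
    (hf : ∀ v, f v ≤ R * dist v u) :
    ∀ᶠ v in 𝓝[≠] u, ENNReal.ofReal (c / (2 * R) ^ s) / edist v u ^ s ≤
      liminf (fun i => ENNReal.ofReal (G (h i v)⁻¹ v)) l := by
  have hsmall : Tendsto (fun v => (2 * R * dist v u)⁻¹) (𝓝[≠] u) atTop := by
    refine tendsto_inv_nhdsGT_zero.comp (tendsto_nhdsWithin_iff.2 ⟨?_, ?_⟩)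
    · have : Continuous fun v => 2 * R * dist v u := by fun_prop
      exact (this.tendsto' u 0 (by simp)).mono_left nhdsWithin_le_nhds
    · filter_upwards [self_mem_nhdsWithin] with v hv
      exact mul_pos (by positivity) (dist_pos.2 hv)
  filter_upwards [self_mem_nhdsWithin, hsmall.eventually_ge_atTop T] with v hv hvT
  have hρ : 0 < dist v u := dist_pos.2 hv
  have hfv : f v < 2 * R * dist v u := (hf v).trans_lt (by nlinarith [mul_pos hR hρ])
  refine le_liminf_of_le (by isBoundedDefault) ?_
  filter_upwards [(hlim v).eventually_lt_const hfv] with i hi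
  have hinv : (2 * R * dist v u)⁻¹ ≤ (h i v)⁻¹ := inv_anti₀ (hpos i v) hi.le
  rw [edist_dist, ← ENNReal.ofReal_pow hρ.le, ← ENNReal.ofReal_div_of_pos (by positivity)]
  refine ENNReal.ofReal_le_ofReal ?_
  calc c / (2 * R) ^ s / dist v u ^ s = c * (2 * R * dist v u)⁻¹ ^ s := by
        rw [div_div, ← mul_pow, inv_pow, div_eq_mul_inv]
    _ ≤ c * (h i v)⁻¹ ^ s := by gcongr
    _ ≤ G (h i v)⁻¹ v := hgr _ (hvT.trans hinv) v

theorem pos_of_tendsto_of_integral_comp_inv_le {X : Type*} [MetricSpace X] [CompactSpace X]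
    [MeasurableSpace X] [OpensMeasurableSpace X] {σ : Measure X} [IsFiniteMeasure σ]
    {G : ℝ → X → ℝ} (hG : ContinuousOn (fun p : ℝ × X => G p.1 p.2) (Ioi 0 ×ˢ univ))
    (hG₀ : ∀ t, 0 < t → ∀ v, 0 ≤ G t v) {u : X} (htop : Tendsto (fun t => G t u) atTop atTop)
    {s : ℕ} {c T : ℝ} (hc : 0 < c) (hgr : ∀ t, T ≤ t → ∀ v, c * t ^ s ≤ G t v) {d : ℝ≥0∞}
    (hd : d ≠ 0) (hσ : ∀ᶠ r in 𝓝[>] 0, d * ENNReal.ofReal r ^ s ≤ σ (ball u r))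
    {h : ℕ → X → ℝ} (hcont : ∀ i, Continuous (h i)) (hpos : ∀ i v, 0 < h i v) {V : ℝ}
    (hV : ∀ i, ∫ v, G (h i v)⁻¹ v ∂σ ≤ V) {f : X → ℝ}
    (hlim : ∀ v, Tendsto (fun i => h i v) atTop (𝓝 (f v))) {R : ℝ}
    (hR : ∀ v, f v ≤ f u + R * dist v u) : 0 < f u := by
  by_contra! hu
  have hu₀ : f u = 0 := le_antisymm hu (ge_of_tendsto' (hlim u) fun i => (hpos i u).le)
  set F : X → ℝ≥0∞ := fun v => liminf (fun i => ENNReal.ofReal (G (h i v)⁻¹ v)) atTop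
  have hFu : F u = ⊤ := by
    refine liminf_ofReal_eq_top (htop.comp (tendsto_inv_nhdsGT_zero.comp ?_))
    exact tendsto_nhdsWithin_iff.2 ⟨hu₀ ▸ hlim u, Eventually.of_forall fun i => hpos i u⟩
  have hfatou : ∫⁻ v, F v ∂σ ≤ ENNReal.ofReal V := lintegral_liminf_le_of_integral_le
    (fun i => continuous_uncurry_comp hG ((hcont i).inv₀ fun v => (hpos i v).ne')
      fun v => inv_pos.2 (hpos i v))
    (fun i v => hG₀ _ (inv_pos.2 (hpos i v)) v) hV
  have hRpos : 0 < max R 1 := lt_max_of_lt_right one_pos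
  have hF := eventually_div_edist_pow_le_liminf (f := f) (u := u) hc hgr hpos hlim hRpos fun v =>
    (hR v).trans (by rw [hu₀, zero_add]; gcongr; exact le_max_left R 1)
  exact ENNReal.ofReal_ne_top (top_unique ((lintegral_eq_top_of_div_edist_pow_le
    (ENNReal.ofReal_pos.2 (by positivity)).ne' hd hσ hF hFu).ge.trans hfatou))

variable {V : Type*} [NormedAddCommGroup V] [NormedSpace ℝ V]

theorem ball_subset_Ioo_smul_image_ball (u : sphere (0 : V) 1) {r : ℝ} (hr : r ≤ 1 / 2) :
    ball ((1 - r / 2) • (u : V)) (r / 4) ⊆ Ioo (0 : ℝ) 1 • (Subtype.val '' ball u r) := by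
  intro x hx
  rw [mem_ball, dist_eq_norm] at hx
  have hr₀ : 0 < r := by linarith [norm_nonneg (x - (1 - r / 2) • (u : V))]
  have hnorm : |‖x‖ - (1 - r / 2)| < r / 4 := by
    refine lt_of_le_of_lt ?_ hx
    have h := abs_norm_sub_norm_le x ((1 - r / 2) • (u : V))
    rwa [norm_smul, norm_eq_of_mem_sphere, mul_one, Real.norm_of_nonneg (by linarith)] at h
  obtain ⟨hlow, hup⟩ := abs_lt.1 hnorm
  have hx₀ : 0 < ‖x‖ := by linarith
  refine mem_smul.2 ⟨‖x‖, ⟨hx₀, by linarith⟩, ‖x‖⁻¹ • x, ⟨⟨‖x‖⁻¹ • x, ?_⟩, ?_, rfl⟩,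
    smul_inv_smul₀ hx₀.ne' x⟩
  · rw [mem_sphere_zero_iff_norm, norm_smul, norm_inv, norm_norm, inv_mul_cancel₀ hx₀.ne']
  · rw [mem_ball, Subtype.dist_eq, dist_eq_norm]
    calc ‖‖x‖⁻¹ • x - u‖ = ‖x‖⁻¹ * ‖x - ‖x‖ • (u : V)‖ := by
          rw [← norm_smul_of_nonneg (inv_nonneg.2 hx₀.le), smul_sub, inv_smul_smul₀ hx₀.ne']
      _ ≤ ‖x‖⁻¹ * (‖x - (1 - r / 2) • (u : V)‖ + ‖((1 - r / 2) - ‖x‖) • (u : V)‖) := by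
          gcongr
          rw [sub_smul _ ‖x‖]
          exact norm_sub_le_norm_sub_add_norm_sub _ _ _
      _ < ‖x‖⁻¹ * (r / 4 + r / 4) := by
          rw [norm_smul, norm_eq_of_mem_sphere, mul_one, Real.norm_eq_abs, abs_sub_comm]
          gcongr
      _ < r := by rw [inv_mul_lt_iff₀ hx₀]; nlinarith

variable [FiniteDimensional ℝ V] [MeasurableSpace V] [BorelSpace V]

theorem pow_finrank_mul_measureReal_ball_le (μ : Measure V) [μ.IsAddHaarMeasure] {S : Set V}
    (hS : S ⊆ ball 0 1) {r : ℝ} (hr₁ : r < 1) (hrS : (1 - r) • S ⊆ S) {x : V}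
    {ρ : ℝ} (hρ : 0 < ρ) (hxS : ball x ρ ⊆ S) (hx : ∀ y ∈ ball x ρ, 1 - r ≤ ‖y‖) :
    ρ ^ Module.finrank ℝ V * μ.real (ball 0 1) ≤ Module.finrank ℝ V * r * μ.real S := by
  -- `S` contains the disjoint sets `(1 - r) • S` and `ball x ρ`; compare volumes.
  set N := Module.finrank ℝ V
  have h1r : 0 < 1 - r := sub_pos.2 hr₁
  have hfin : ∀ {T : Set V}, T ⊆ S → μ T ≠ ⊤ := fun hT =>
    ne_top_of_le_ne_top measure_ball_lt_top.ne (measure_mono (hT.trans hS))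
  have hdisj : Disjoint ((1 - r) • S) (ball x ρ) := by
    refine disjoint_left.2 fun y hy hyx => ?_
    obtain ⟨z, hz, rfl⟩ := hy
    have hzx := hx _ hyx
    have hz₁ := mem_ball_zero_iff.1 (hS hz)
    simp only [norm_smul, Real.norm_of_nonneg h1r.le] at hzx
    nlinarith
  have hadd : (1 - r) ^ N * μ.real S + ρ ^ N * μ.real (ball 0 1) ≤ μ.real S := calc
    _ = μ.real ((1 - r) • S) + μ.real (ball x ρ) := by
      rw [measureReal_def, measureReal_def, measureReal_def, measureReal_def,
        Measure.addHaar_smul_of_nonneg μ h1r.le, Measure.addHaar_ball_of_pos μ x hρ,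
        ENNReal.toReal_mul, ENNReal.toReal_mul, ENNReal.toReal_ofReal (by positivity),
        ENNReal.toReal_ofReal (by positivity)]
    _ = μ.real ((1 - r) • S ∪ ball x ρ) :=
      (measureReal_union hdisj measurableSet_ball (hfin hrS) (hfin hxS)).symm
    _ ≤ μ.real S := measureReal_mono (union_subset hrS hxS) (hfin subset_rfl)
  have hbern : 1 + N * -r ≤ (1 + -r) ^ N := one_add_mul_le_pow (by linarith) N
  have := mul_le_mul_of_nonneg_right hbern (measureReal_nonneg (μ := μ) (s := S))
  rw [← sub_eq_add_neg] at this
  linarith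

theorem div_four_pow_mul_le_toSphere_ball (μ : Measure V) [μ.IsAddHaarMeasure]
    (u : sphere (0 : V) 1) {r : ℝ} (hr₀ : 0 < r) (hr : r ≤ 1 / 2) :
    (r / 4) ^ Module.finrank ℝ V * μ.real (ball 0 1) ≤ r * μ.toSphere.real (ball u r) := by
  set S : Set V := Ioo (0 : ℝ) 1 • (Subtype.val '' ball u r)
  have hS : S ⊆ ball 0 1 := by
    rintro _ ⟨t, ht, _, ⟨v, -, rfl⟩, rfl⟩
    simpa only [mem_ball_zero_iff, norm_smul, norm_eq_of_mem_sphere, mul_one,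
      Real.norm_of_nonneg ht.1.le] using ht.2
  have hrS : (1 - r) • S ⊆ S := by
    rintro _ ⟨_, ⟨t, ht, v, hv, rfl⟩, rfl⟩
    exact mem_smul.2 ⟨(1 - r) * t, ⟨mul_pos (by linarith) ht.1, by nlinarith [ht.1, ht.2]⟩, v, hv,
      mul_smul _ _ _⟩
  have hcap : ∀ y ∈ ball ((1 - r / 2) • (u : V)) (r / 4), 1 - r ≤ ‖y‖ := fun y hy => by
    have h := norm_sub_norm_le ((1 - r / 2) • (u : V)) y
    rw [norm_smul, norm_eq_of_mem_sphere, mul_one, Real.norm_of_nonneg (by linarith)] at h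
    rw [mem_ball', dist_eq_norm] at hy
    linarith
  rw [measureReal_def _ (ball u r), Measure.toSphere_apply' _ measurableSet_ball,
    ENNReal.toReal_mul, ENNReal.toReal_natCast, ← mul_assoc, mul_comm r]
  exact pow_finrank_mul_measureReal_ball_le μ hS (by linarith) hrS (by linarith)
    (ball_subset_Ioo_smul_image_ball u hr) hcap

end Singularity

section Existence

open Metric

variable {φ : ℝ → ℝ} {μ : Measure (Sph n)} {G : ℝ → Sph n → ℝ}

instance : IsFiniteMeasure (sphMeasure n) :=
  inferInstanceAs (IsFiniteMeasure (volume : Measure (E n)).toSphere)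

instance : (sphMeasure n).IsOpenPosMeasure :=
  inferInstanceAs ((volume : Measure (E n)).toSphere.IsOpenPosMeasure)

instance [Nonempty (Sph n)] : NeZero (sphMeasure n) :=
  ⟨fun h => isOpen_univ.measure_ne_zero (sphMeasure n) univ_nonempty
    (by rw [h, Measure.coe_zero, Pi.zero_apply])⟩

theorem exists_mul_pow_le_sphMeasure_ball (u : Sph n) : ∃ d : ENNReal, d ≠ 0 ∧
    ∀ᶠ r in 𝓝[>] 0, d * ENNReal.ofReal r ^ (n - 1) ≤ sphMeasure n (ball u r) := by
  have hvol : 0 < (volume : Measure (E n)).real (ball 0 1) :=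
    ENNReal.toReal_pos (measure_ball_pos _ _ one_pos).ne' measure_ball_lt_top.ne
  refine ⟨ENNReal.ofReal ((1 / 4) ^ n * (volume : Measure (E n)).real (ball 0 1)),
    (ENNReal.ofReal_pos.2 (by positivity)).ne', ?_⟩
  filter_upwards [Ioo_mem_nhdsGT one_half_pos] with r ⟨hr₀, hr⟩
  have h : r * ((1 / 4) ^ n * (volume : Measure (E n)).real (ball 0 1) * r ^ (n - 1)) ≤
      r * (sphMeasure n).real (ball u r) := calc
    _ = (r / 4) ^ n * (volume : Measure (E n)).real (ball 0 1) := by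
      rw [div_pow, div_pow, one_pow, ← mul_pow_sub_one (dim_ne_zero u) r]
      ring
    _ ≤ r * (sphMeasure n).real (ball u r) := by
      simpa only [sphMeasure, finrank_euclideanSpace_fin] using
        div_four_pow_mul_le_toSphere_ball (volume : Measure (E n)) u hr₀ hr.le
  rw [← ENNReal.ofReal_pow hr₀.le, ← ENNReal.ofReal_mul (by positivity)]
  exact ENNReal.ofReal_le_of_le_toReal (le_of_mul_le_mul_left h hr₀)

theorem dualVol_polarBody (G : ℝ → Sph n → ℝ) {Q : ConvexBody (E n)} (hQ : Q ∈ bodiesO n) :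
    dualVol G (polarBody (Q : Set (E n))) =
      ∫ u, G (supportFun (Q : Set (E n)) u)⁻¹ u ∂sphMeasure n := by
  simp only [dualVol, radialFun_polarBody Q.isCompact Q.nonempty (mem_bodiesO_iff.1 hQ _)]

theorem dualVol_unitBall (G : ℝ → Sph n → ℝ) :
    dualVol G (unitBall n) = ∫ u, G 1 u ∂sphMeasure n := by
  simp only [dualVol, radialFun_unitBall]

theorem mem_tildeB_iff {Q : ConvexBody (E n)} : Q ∈ tildeB G ↔ Q ∈ bodiesO n ∧
    ∫ u, G (supportFun (Q : Set (E n)) u)⁻¹ u ∂sphMeasure n = ∫ u, G 1 u ∂sphMeasure n :=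
  and_congr_right fun hQ => by rw [dualVol_polarBody G hQ, dualVol_unitBall]

theorem tildeB_nonempty (G : ℝ → Sph n → ℝ) : (tildeB G).Nonempty := by
  let B : ConvexBody (E n) := ⟨closedBall 0 1, convex_closedBall _ _, isCompact_closedBall _ _,
    nonempty_closedBall.2 zero_le_one⟩
  have hB : ∀ u, supportFun (B : Set (E n)) u = 1 := supportFun_closedBall zero_le_one
  exact ⟨B, mem_tildeB_iff.2
    ⟨mem_bodiesO_iff.2 fun u => hB u ▸ one_pos, by simp only [hB, inv_one]⟩⟩

theorem bddBelow_objective_image (hφ₀ : ∀ t, 0 < t → 0 ≤ φ t) (μ : Measure (Sph n))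
    {B : Set (ConvexBody (E n))} (hB : B ⊆ bodiesO n) : BddBelow (objective φ μ '' B) :=
  ⟨0, forall_mem_image.2 fun _ hQ => integral_nonneg fun u => hφ₀ _ (mem_bodiesO_iff.1 (hB hQ) u)⟩

theorem measure_inner_pos_ne_zero (hμ : ¬ConcentratedOnHemisphere μ) (v : Sph n) :
    μ {u : Sph n | 0 < inner ℝ (v : E n) (u : E n)} ≠ 0 := by
  refine fun h => hμ ⟨-v, ?_⟩
  convert h using 2
  ext u
  rw [mem_compl_iff, mem_ofPred_eq, mem_ofPred_eq, not_le, coe_neg_sphere, inner_neg_right,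
    neg_lt_zero, real_inner_comm]

theorem tendsto_supportFun_atTop {ι : Type*} {l : Filter ι} {K : ι → Set (E n)}
    (hK : ∀ i, IsCompact (K i)) {r : ι → ℝ} (hr : Tendsto r l atTop) {w : ι → E n} {v : E n}
    (hw : Tendsto w l (𝓝 v)) (hmem : ∀ i, r i • w i ∈ K i) {u : Sph n}
    (hu : 0 < inner ℝ v (u : E n)) : Tendsto (fun i => supportFun (K i) u) l atTop := by
  refine tendsto_atTop_mono (fun i => ?_) (hr.atTop_mul_pos hu (hw.inner tendsto_const_nhds))
  rw [← real_inner_smul_left]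
  exact inner_le_supportFun (hK i) (hmem i) u

theorem exists_norm_le_of_objective_le [IsFiniteMeasure μ] (hφ : ContinuousOn φ (Ioi 0))
    (hφ₀ : ∀ t, 0 < t → 0 ≤ φ t) (hφtop : Tendsto φ atTop atTop)
    (hμ : ¬ConcentratedOnHemisphere μ) (C : ℝ) :
    ∃ R, ∀ Q ∈ bodiesO n, objective φ μ Q ≤ C → ∀ x ∈ Q, ‖x‖ ≤ R := by
  by_contra! hex
  choose Q hQ hC x hxQ hx using fun k : ℕ => hex k
  have hx₀ : ∀ k, ‖x k‖ ≠ 0 := fun k => ((Nat.cast_nonneg k).trans_lt (hx k)).ne'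
  let v : ℕ → Sph n := fun k => ⟨‖x k‖⁻¹ • x k, by
    rw [mem_sphere_zero_iff_norm, norm_smul, norm_inv, norm_norm, inv_mul_cancel₀ (hx₀ k)]⟩
  have hv : ∀ k, ‖x k‖ • (v k : E n) ∈ (Q k : Set (E n)) := fun k =>
    (smul_inv_smul₀ (hx₀ k) (x k)).symm ▸ hxQ k
  obtain ⟨w, s, hs, hw⟩ := CompactSpace.tendsto_subseq v
  have hnorm : Tendsto (fun i => ‖x (s i)‖) atTop atTop :=
    tendsto_atTop_mono (fun i => (hx (s i)).le) (tendsto_natCast_atTop_atTop.comp hs.tendsto_atTop)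
  have htop : ∀ u : Sph n, 0 < inner ℝ (w : E n) (u : E n) →
      Tendsto (fun i => φ (supportFun (Q (s i) : Set (E n)) u)) atTop atTop := fun u hu =>
    hφtop.comp (tendsto_supportFun_atTop (fun i => (Q (s i)).isCompact) hnorm
      ((continuous_subtype_val.tendsto w).comp hw) (fun i => hv (s i)) hu)
  have hpos : ∀ i u, 0 < supportFun (Q (s i) : Set (E n)) u := fun i =>
    mem_bodiesO_iff.1 (hQ (s i))
  exact measure_inner_pos_ne_zero hμ w (measure_mono_null htop
    (measure_tendsto_atTop_eq_zero_of_integral_le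
      (fun i => hφ.comp_continuous (continuous_supportFun_convexBody _) (hpos i))
      (fun i u => hφ₀ _ (hpos i u)) fun i => hC (s i)))

theorem exists_isSolution_tildeB [IsFiniteMeasure μ] (hφ : ContinuousOn φ (Ioi 0))
    (hφ₀ : ∀ t, 0 < t → 0 ≤ φ t) (hφtop : Tendsto φ atTop atTop)
    (hμ : ¬ConcentratedOnHemisphere μ)
    (hG : ContinuousOn (fun p : ℝ × Sph n => G p.1 p.2) (Ioi 0 ×ˢ univ))
    (hG₀ : ∀ t, 0 < t → ∀ u, 0 ≤ G t u) (hGtop : ∀ u, Tendsto (fun t => G t u) atTop atTop)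
    {c T : ℝ} (hc : 0 < c) (hgr : ∀ t, T ≤ t → ∀ u, c * t ^ (n - 1) ≤ G t u) :
    ∃ M, IsSolution φ μ (tildeB G) M := by
  obtain ⟨y, hy, hylim, hymem⟩ :=
    exists_seq_tendsto_sInf ((tildeB_nonempty G).image (objective φ μ))
      (bddBelow_objective_image hφ₀ μ fun _ hQ => hQ.1)
  choose Q hQ hQy using hymem
  obtain ⟨R, hR⟩ := exists_norm_le_of_objective_le hφ hφ₀ hφtop hμ (y 0)
  obtain ⟨M, s, hs, hlim⟩ := exists_subseq_tendstoUniformly_supportFun Q fun i =>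
    hR (Q i) (hQ i).1 ((hQy i).trans_le (hy (Nat.zero_le i)))
  have hpos : ∀ i u, 0 < supportFun (Q (s i) : Set (E n)) u := fun i =>
    mem_bodiesO_iff.1 (hQ (s i)).1
  have hM : ∀ u, 0 < supportFun (M : Set (E n)) u := fun u => by
    obtain ⟨r, hr⟩ := M.isCompact.isBounded.exists_norm_le
    obtain ⟨d, hd, hcap⟩ := exists_mul_pow_le_sphMeasure_ball u
    exact pos_of_tendsto_of_integral_comp_inv_le hG hG₀ (hGtop u) hc hgr hd hcap
      (fun i => continuous_supportFun_convexBody (Q (s i))) hpos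
      (fun i => (mem_tildeB_iff.1 (hQ (s i))).2.le) hlim.tendsto_at
      fun v => supportFun_le_add_mul_dist M.isCompact M.nonempty hr v u
  have hvol := tendsto_integral_of_tendstoUniformly (ν := sphMeasure n)
    (H := fun t u => G t⁻¹ u) isOpen_Ioi (continuousOn_comp_inv hG)
    (fun i => continuous_supportFun_convexBody (Q (s i))) (continuous_supportFun_convexBody M)
    hM hlim
  have hobj : Tendsto (fun i => objective φ μ (Q (s i))) atTop (𝓝 (objective φ μ M)) :=
    tendsto_integral_of_tendstoUniformly (H := fun t _ => φ t) isOpen_Ioi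
      (hφ.comp continuousOn_fst fun _ hp => hp.1)
      (fun i => continuous_supportFun_convexBody (Q (s i))) (continuous_supportFun_convexBody M)
      hM hlim
  refine ⟨M, mem_tildeB_iff.2 ⟨mem_bodiesO_iff.2 hM, ?_⟩, ?_⟩
  · exact tendsto_nhds_unique hvol
      (tendsto_const_nhds.congr fun i => (mem_tildeB_iff.1 (hQ (s i))).2.symm)
  · exact tendsto_nhds_unique hobj
      ((hylim.comp hs.tendsto_atTop).congr fun i => (hQy (s i)).symm)

end Existence

section Uniqueness

variable {φ : ℝ → ℝ} {μ : Measure (Sph n)} {G : ℝ → Sph n → ℝ}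

theorem ClassGI.continuous (hG : ClassGI G) {t : ℝ} (ht : 0 < t) : Continuous (G t) :=
  continuous_uncurry_comp hG.continuousOn continuous_const fun _ => ht

theorem ClassGI.nonneg (hG : ClassGI G) : ∀ t, 0 < t → ∀ u, 0 ≤ G t u :=
  fun t ht u => (hG.pos t u ht).le

theorem ClassGI.comp_mul (hG : ClassGI G) {f : Sph n → ℝ} (hf : Continuous f)
    (hf₀ : ∀ u, 0 < f u) : ClassGI fun t u => G (t * f u) u where
  pos t u ht := hG.pos _ u (mul_pos ht (hf₀ u))
  continuousOn := hG.continuousOn.comp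
    (f := fun p : ℝ × Sph n => (p.1 * f p.2, p.2)) (by fun_prop)
    fun p hp => ⟨mul_pos hp.1 (hf₀ p.2), mem_univ _⟩
  strictMonoOn u s hs t ht hst := hG.strictMonoOn u (mul_pos hs (hf₀ u)) (mul_pos ht (hf₀ u))
    (mul_lt_mul_of_pos_right hst (hf₀ u))
  tendsto_zero u := (hG.tendsto_zero u).comp <| tendsto_nhdsWithin_iff.2
    ⟨((continuous_mul_const (f u)).tendsto' 0 0 (zero_mul _)).mono_left nhdsWithin_le_nhds,
      eventually_mem_nhdsWithin.mono fun _ ht => mul_pos ht (hf₀ u)⟩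
  tendsto_top u := (hG.tendsto_top u).comp (tendsto_id.atTop_mul_const (hf₀ u))

theorem ClassGI.strictMonoOn_integral [Nonempty (Sph n)] (hG : ClassGI G) :
    StrictMonoOn (fun t => ∫ u, G t u ∂sphMeasure n) (Ioi 0) :=
  DualPolarOrlicz.strictMonoOn_integral (fun _ ht => hG.continuous ht) hG.strictMonoOn

theorem ClassGI.exists_integral_eq [Nonempty (Sph n)] (hG : ClassGI G) {c : ℝ} (hc : 0 < c) :
    ∃ t, 0 < t ∧ ∫ u, G t u ∂sphMeasure n = c :=
  exists_integral_eq_of_monotoneOn hG.continuousOn (fun u => (hG.strictMonoOn u).monotoneOn)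
    hG.tendsto_zero hG.tendsto_top hc

theorem ClassGI.integral_pos [Nonempty (Sph n)] (hG : ClassGI G) {t : ℝ} (ht : 0 < t) :
    0 < ∫ u, G t u ∂sphMeasure n :=
  (integral_nonneg (hG.nonneg _ (half_pos ht))).trans_lt
    (hG.strictMonoOn_integral (half_pos ht) ht (half_lt_self ht))

theorem strictConvexOn_comp_inv {f : ℝ → ℝ} (hf : ConvexOn ℝ (Ioi 0) f)
    (hmono : StrictMonoOn f (Ioi 0)) : StrictConvexOn ℝ (Ioi 0) fun t => f t⁻¹ := by
  have himage : (fun t : ℝ => t⁻¹) '' Ioi 0 = Ioi 0 := by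
    simp only [image_inv_eq_inv, Set.ext_iff, Set.mem_inv, mem_Ioi, inv_pos, implies_true]
  have hinv : StrictConvexOn ℝ (Ioi 0) fun t : ℝ => t⁻¹ := by
    simpa only [zpow_neg_one] using
      strictConvexOn_zpow (m := -1) (by norm_num) (by norm_num)
  exact (himage.symm ▸ hf).comp_strictConvexOn hinv (himage.symm ▸ hmono)

theorem exists_smul_mem_tildeB [Nonempty (Sph n)] (hG : ClassGI G) {K : ConvexBody (E n)}
    (hK : K ∈ bodiesO n) (hvol : ∫ u, G (supportFun (K : Set (E n)) u)⁻¹ u ∂sphMeasure n <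
      ∫ u, G 1 u ∂sphMeasure n) : ∃ c ∈ Ioo (0 : ℝ) 1, c • K ∈ tildeB G := by
  have hpos := mem_bodiesO_iff.1 hK
  have hH : ClassGI fun t u => G (t * (supportFun (K : Set (E n)) u)⁻¹) u :=
    hG.comp_mul ((continuous_supportFun_convexBody K).inv₀ fun u => (hpos u).ne')
      fun u => inv_pos.2 (hpos u)
  obtain ⟨t, ht, hteq⟩ := hH.exists_integral_eq (hG.integral_pos one_pos)
  have ht₁ : 1 < t := (hH.strictMonoOn_integral.lt_iff_lt (mem_Ioi.2 one_pos) ht).1 (by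
    simpa only [one_mul, hteq] using hvol)
  have hsupp : ∀ u, supportFun ((t⁻¹ • K : ConvexBody (E n)) : Set (E n)) u =
      t⁻¹ * supportFun (K : Set (E n)) u := by
    rw [ConvexBody.coe_smul]
    exact supportFun_smul _ (inv_pos.2 ht).le
  refine ⟨t⁻¹, ⟨inv_pos.2 ht, inv_lt_one_of_one_lt₀ ht₁⟩,
    mem_tildeB_iff.2 ⟨mem_bodiesO_iff.2 fun u => ?_, ?_⟩⟩
  · rw [hsupp]
    exact mul_pos (inv_pos.2 ht) (hpos u)
  · simp only [hsupp, mul_inv, inv_inv, hteq]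

theorem objective_smul_lt [IsFiniteMeasure μ] [NeZero μ] (hφ : ContinuousOn φ (Ioi 0))
    (hmono : StrictMonoOn φ (Ioi 0)) {K : ConvexBody (E n)} (hK : K ∈ bodiesO n) {c : ℝ}
    (hc : c ∈ Ioo (0 : ℝ) 1) : objective φ μ (c • K) < objective φ μ K := by
  have hpos := mem_bodiesO_iff.1 hK
  have h := strictMonoOn_integral (ν := μ) (s := Ioi 0)
    (G := fun t u => φ (t * supportFun (K : Set (E n)) u))
    (fun t ht => hφ.comp_continuous ((continuous_supportFun_convexBody K).const_mul t)
      fun u => mul_pos ht (hpos u))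
    (fun u s hs t ht hst => hmono (mul_pos hs (hpos u)) (mul_pos ht (hpos u))
      (mul_lt_mul_of_pos_right hst (hpos u))) (mem_Ioi.2 hc.1) (mem_Ioi.2 one_pos) hc.2
  simpa only [objective, ConvexBody.coe_smul, supportFun_smul _ hc.1.le, one_mul] using h

theorem objective_combo_le [IsFiniteMeasure μ] (hφ : ConvexOn ℝ (Ioi 0) φ)
    {K L : ConvexBody (E n)} (hK : K ∈ bodiesO n) (hL : L ∈ bodiesO n) {a b : ℝ} (ha : 0 ≤ a)
    (hb : 0 ≤ b) (hab : a + b = 1) :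
    objective φ μ (a • K + b • L) ≤ a * objective φ μ K + b * objective φ μ L := by
  simp only [objective, supportFun_combo K L ha hb]
  exact integral_comp_combo_le (H := fun t _ => φ t)
    ((hφ.continuousOn isOpen_Ioi).comp continuousOn_fst fun _ hp => hp.1) (fun _ => hφ)
    (continuous_supportFun_convexBody K) (continuous_supportFun_convexBody L)
    (mem_bodiesO_iff.1 hK) (mem_bodiesO_iff.1 hL) ha hb hab

theorem integral_comp_inv_supportFun_combo_lt (hG : ClassGI G)
    (hGconv : ∀ u, ConvexOn ℝ (Ioi 0) fun t => G t u) {K L : ConvexBody (E n)}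
    (hK : K ∈ bodiesO n) (hL : L ∈ bodiesO n) (hKL : K ≠ L) {a b : ℝ} (ha : 0 < a)
    (hb : 0 < b) (hab : a + b = 1) :
    ∫ u, G (supportFun ((a • K + b • L : ConvexBody (E n)) : Set (E n)) u)⁻¹ u ∂sphMeasure n <
      a * ∫ u, G (supportFun (K : Set (E n)) u)⁻¹ u ∂sphMeasure n +
        b * ∫ u, G (supportFun (L : Set (E n)) u)⁻¹ u ∂sphMeasure n := by
  simp only [supportFun_combo K L ha.le hb.le]
  exact integral_comp_combo_lt (H := fun t u => G t⁻¹ u) (continuousOn_comp_inv hG.continuousOn)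
    (fun u => strictConvexOn_comp_inv (hGconv u) (hG.strictMonoOn u))
    (continuous_supportFun_convexBody K) (continuous_supportFun_convexBody L)
    (mem_bodiesO_iff.1 hK) (mem_bodiesO_iff.1 hL) (supportFun_injective.ne hKL) ha hb hab

theorem eq_of_isSolution_tildeB [IsFiniteMeasure μ] [NeZero μ]
    (hφ₀ : ∀ t, 0 < t → 0 ≤ φ t) (hφmono : StrictMonoOn φ (Ioi 0))
    (hφconv : ConvexOn ℝ (Ioi 0) φ) (hG : ClassGI G)
    (hGconv : ∀ u, ConvexOn ℝ (Ioi 0) fun t => G t u) {K L : ConvexBody (E n)}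
    (hK : IsSolution φ μ (tildeB G) K) (hL : IsSolution φ μ (tildeB G) L) : K = L := by
  by_contra hKL
  have : Nonempty (Sph n) := μ.nonempty_of_neZero
  obtain ⟨⟨hK₀, hKvol⟩, hKinf⟩ := And.imp_left mem_tildeB_iff.1 hK
  obtain ⟨⟨hL₀, hLvol⟩, hLinf⟩ := And.imp_left mem_tildeB_iff.1 hL
  have hhalf : (0 : ℝ) < 1 / 2 := one_half_pos
  set A : ConvexBody (E n) := (1 / 2 : ℝ) • K + (1 / 2 : ℝ) • L
  have hA : A ∈ bodiesO n := mem_bodiesO_iff.2 fun u => by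
    rw [supportFun_combo K L hhalf.le hhalf.le]
    exact add_pos (mul_pos hhalf (mem_bodiesO_iff.1 hK₀ u))
      (mul_pos hhalf (mem_bodiesO_iff.1 hL₀ u))
  have hAvol := integral_comp_inv_supportFun_combo_lt hG hGconv hK₀ hL₀ hKL hhalf hhalf
    (add_halves 1)
  rw [hKvol, hLvol, ← add_mul, add_halves, one_mul] at hAvol
  have hAobj := objective_combo_le (μ := μ) hφconv hK₀ hL₀ hhalf.le hhalf.le (add_halves 1)
  rw [hKinf, hLinf, ← add_mul, add_halves, one_mul] at hAobj
  obtain ⟨c, hc, hcA⟩ := exists_smul_mem_tildeB hG hA hAvol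
  refine (csInf_le (bddBelow_objective_image hφ₀ μ fun _ hQ => hQ.1)
    (mem_image_of_mem _ hcA)).not_gt ?_
  exact (objective_smul_lt (hφconv.continuousOn isOpen_Ioi) hφmono hA hc).trans_le hAobj

theorem existsUnique_isSolution_tildeB [IsFiniteMeasure μ] [NeZero μ]
    (hφ₀ : ∀ t, 0 < t → 0 ≤ φ t) (hφtop : Tendsto φ atTop atTop)
    (hφmono : StrictMonoOn φ (Ioi 0)) (hφconv : ConvexOn ℝ (Ioi 0) φ)
    (hμ : ¬ConcentratedOnHemisphere μ) (hG : ClassGI G)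
    (hGconv : ∀ u, ConvexOn ℝ (Ioi 0) fun t => G t u) {c T : ℝ} (hc : 0 < c)
    (hgr : ∀ t, T ≤ t → ∀ u, c * t ^ (n - 1) ≤ G t u) : ∃! M, IsSolution φ μ (tildeB G) M :=
  existsUnique_of_exists_of_unique
    (exists_isSolution_tildeB (hφconv.continuousOn isOpen_Ioi) hφ₀ hφtop hμ hG.continuousOn
      hG.nonneg hG.tendsto_top hc hgr)
    fun _ _ => eq_of_isSolution_tildeB hφ₀ hφmono hφconv hG hGconv

end Uniqueness

section Homogeneous

variable {G : ℝ → Sph n → ℝ}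

theorem ClassGI.homDualVol_eq_iff [Nonempty (Sph n)] (hG : ClassGI G) {K : Set (E n)}
    (hK : Continuous (radialFun K)) (hpos : ∀ u, 0 < radialFun K u) {η : ℝ} (hη : 0 < η) :
    homDualVol G K = η⁻¹ ↔ ∫ u, G (η * radialFun K u) u ∂sphMeasure n = 1 := by
  have hH : ClassGI fun t u => G (t * radialFun K u) u := hG.comp_mul hK hpos
  obtain ⟨t, ht, hteq⟩ := hH.exists_integral_eq one_pos
  have hset : {s : ℝ | 0 < s ∧ ∫ u, G (radialFun K u / s) u ∂sphMeasure n ≤ 1} = Ici t⁻¹ := by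
    ext s
    rw [mem_Ici, mem_ofPred_eq, ← and_iff_right_of_imp (inv_pos.2 ht).trans_le]
    refine and_congr_right fun hs => ?_
    rw [inv_le_comm₀ ht hs, ← hH.strictMonoOn_integral.le_iff_le (inv_pos.2 hs) ht]
    simp only [hteq, div_eq_inv_mul]
  have hinj := hH.strictMonoOn_integral.injOn.eq_iff hη ht
  rw [hteq] at hinj
  rw [homDualVol, hset, csInf_Ici, inv_inj, hinj, eq_comm]

theorem ClassGI.exists_hatB_eq_tildeB [Nonempty (Sph n)] (hG : ClassGI G) :
    ∃ η, 0 < η ∧ hatB G = tildeB fun t u => G (t * η) u := by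
  obtain ⟨η, hη, hηeq⟩ :=
    (hG.comp_mul continuous_const fun _ => one_pos).exists_integral_eq one_pos
  refine ⟨η, hη, Set.ext fun Q => ?_⟩
  have hball : homDualVol G (unitBall n) = η⁻¹ :=
    (hG.homDualVol_eq_iff (funext (radialFun_unitBall (n := n)) ▸ continuous_const)
      (fun u => (radialFun_unitBall u).symm ▸ one_pos) hη).2
      (by simpa only [radialFun_unitBall] using hηeq)
  rw [mem_tildeB_iff, hatB, mem_ofPred_eq, hball]
  refine and_congr_right fun hQ => ?_
  have hpos := mem_bodiesO_iff.1 hQ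
  have hrad : radialFun (polarBody (Q : Set (E n))) =
      fun u => (supportFun (Q : Set (E n)) u)⁻¹ :=
    funext fun u => radialFun_polarBody Q.isCompact Q.nonempty (hpos u)
  rw [hG.homDualVol_eq_iff (hrad ▸ (continuous_supportFun_convexBody Q).inv₀
    fun u => (hpos u).ne') (fun u => hrad ▸ inv_pos.2 (hpos u)) hη, hrad]
  simp only [mul_one] at hηeq
  simp only [one_mul, hηeq, mul_comm η]

theorem GrowthCond.exists_mul_pow_le (hG : ∀ t, 0 < t → ∀ u, 0 ≤ G t u) {q : ℝ}
    (h : GrowthCond G q) {m : ℕ} (hm : m ≤ q) :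
    ∃ c, 0 < c ∧ ∀ t, 1 ≤ t → ∀ u, c * t ^ m ≤ G t u := by
  have hbdd : BddBelow ((fun p : ℝ × Sph n => G p.1 p.2 / p.1 ^ q) '' (Ici 1 ×ˢ univ)) :=
    ⟨0, forall_mem_image.2 fun p hp => by
      have hp₀ : 0 < p.1 := one_pos.trans_le hp.1
      exact div_nonneg (hG _ hp₀ _) (Real.rpow_nonneg hp₀.le _)⟩
  refine ⟨_, h, fun t ht u => ?_⟩
  have ht₀ : 0 < t := one_pos.trans_le ht
  calc _ ≤ _ * t ^ q := by
        gcongr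
        · exact h.le
        · rw [← Real.rpow_natCast]
          exact Real.rpow_le_rpow_of_exponent_le ht hm
    _ ≤ G t u := (le_div_iff₀ (Real.rpow_pos_of_pos ht₀ q)).1
      (csInf_le hbdd (mem_image_of_mem _ (mk_mem_prod ht (mem_univ u))))

theorem convexOn_comp_mul {f : ℝ → ℝ} (hf : ConvexOn ℝ (Ioi 0) f) {η : ℝ} (hη : 0 < η) :
    ConvexOn ℝ (Ioi 0) fun t => f (t * η) := by
  have hpre : (LinearMap.mulRight ℝ η) ⁻¹' Ioi 0 = Ioi 0 :=
    (preimage_mul_const_Ioi₀ 0 hη).trans (by rw [zero_div])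
  exact hpre ▸ hf.comp_linearMap (LinearMap.mulRight ℝ η)

end Homogeneous

end DualPolarOrlicz

open DualPolarOrlicz in
theorem mainTheorem1_general {n : ℕ} {φ : ℝ → ℝ} (hφ : ContinuousOn φ (Ioi 0))
    (hφ₀ : ∀ t, 0 < t → 0 ≤ φ t) (hφtop : Tendsto φ atTop atTop) {μ : Measure (Sph n)}
    [IsFiniteMeasure μ] [NeZero μ] (hμ : ¬ConcentratedOnHemisphere μ) {G : ℝ → Sph n → ℝ}
    (hG : ClassGI G) {q : ℝ} (hq : (n : ℝ) - 1 ≤ q) (hGq : GrowthCond G q) :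
    ((∃ M, IsSolution φ μ (tildeB G) M) ∧
      (StrictMonoOn φ (Ioi 0) → ConvexOn ℝ (Ioi 0) φ →
        (∀ u, ConvexOn ℝ (Ioi 0) fun t => G t u) → ∃! M, IsSolution φ μ (tildeB G) M)) ∧
    ((∃ M, IsSolution φ μ (hatB G) M) ∧
      (StrictMonoOn φ (Ioi 0) → ConvexOn ℝ (Ioi 0) φ →
        (∀ u, ConvexOn ℝ (Ioi 0) fun t => G t u) → ∃! M, IsSolution φ μ (hatB G) M)) := by
  have hne : Nonempty (Sph n) := μ.nonempty_of_neZero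
  have hn : ((n - 1 : ℕ) : ℝ) ≤ q := by
    rwa [Nat.cast_pred (Nat.pos_of_ne_zero (dim_ne_zero hne.some))]
  obtain ⟨c, hc, hcG⟩ := hGq.exists_mul_pow_le hG.nonneg hn
  obtain ⟨η, hη, hB⟩ := hG.exists_hatB_eq_tildeB
  have hH : ClassGI fun t u => G (t * η) u := hG.comp_mul continuous_const fun _ => hη
  have hcη : 0 < c * η ^ (n - 1) := by positivity
  have hcH : ∀ t, η⁻¹ ≤ t → ∀ u, c * η ^ (n - 1) * t ^ (n - 1) ≤ G (t * η) u := fun t ht u => by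
    rw [mul_assoc, ← mul_pow, mul_comm η]
    exact hcG _ ((inv_le_iff_one_le_mul₀ hη).1 ht) u
  rw [hB]
  exact ⟨⟨exists_isSolution_tildeB hφ hφ₀ hφtop hμ hG.continuousOn hG.nonneg hG.tendsto_top hc hcG,
      fun hmono hφc hGc => existsUnique_isSolution_tildeB hφ₀ hφtop hmono hφc hμ hG hGc hc hcG⟩,
    exists_isSolution_tildeB hφ hφ₀ hφtop hμ hH.continuousOn hH.nonneg hH.tendsto_top hcη hcH,
      fun hmono hφc hGc => existsUnique_isSolution_tildeB hφ₀ hφtop hmono hφc hμ hH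
        (fun u => convexOn_comp_mul (hGc u) hη) hcη hcH⟩

theorem mainTheorem1 (n : ℕ) (φ : ℝ → ℝ) (hφ : DualPolarOrlicz.ClassI φ)
    (μ : Measure (DualPolarOrlicz.Sph n)) [IsFiniteMeasure μ] (hμ0 : μ ≠ 0)
    (hμ : ¬ DualPolarOrlicz.ConcentratedOnHemisphere μ)
    (G : ℝ → DualPolarOrlicz.Sph n → ℝ) (hG : DualPolarOrlicz.ClassGI G)
    (hGq : ∃ q : ℝ, (n : ℝ) - 1 ≤ q ∧ DualPolarOrlicz.GrowthCond G q) :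
    ((∃ M, DualPolarOrlicz.IsSolution φ μ (DualPolarOrlicz.tildeB G) M) ∧
      (ConvexOn ℝ (Ioi 0) φ → (∀ u, ConvexOn ℝ (Ioi 0) (fun t => G t u)) →
        ∃! M, DualPolarOrlicz.IsSolution φ μ (DualPolarOrlicz.tildeB G) M)) ∧
    ((∃ M, DualPolarOrlicz.IsSolution φ μ (DualPolarOrlicz.hatB G) M) ∧
      (ConvexOn ℝ (Ioi 0) φ → (∀ u, ConvexOn ℝ (Ioi 0) (fun t => G t u)) →
        ∃! M, DualPolarOrlicz.IsSolution φ μ (DualPolarOrlicz.hatB G) M)) := by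
  obtain ⟨q, hq, hgrowth⟩ := hGq
  have : NeZero μ := ⟨hμ0⟩
  have h := mainTheorem1_general hφ.continuousOn (fun t ht => (hφ.pos t ht).le) hφ.tendsto_top hμ
    hG hq hgrowth
  exact ⟨h.1.imp_right fun hu => hu hφ.strictMonoOn, h.2.imp_right fun hu => hu hφ.strictMonoOn⟩
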